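/- Let $n,T\ge 0$ and $K\ge 1$ be integers. Let $U:\mathbb R^T\to\mathbb R$ be convex and differentiable with $\|\nabla U(x)-\nabla U(y)\|\le L\|x-y\|$ for all $x,y$, where $L>0$ and $\|\cdot\|$ is the Euclidean norm. Let $\mathcal C_1,\dots,\mathcal C_n\subset\mathbb R^T$ be nonempty, closed and convex, let $\Pi_{\mathcal C_i}$ be the Euclidean projection onto $\mathcal C_i$, let $$U^*=\inf\Bigl\{U\bigl(\textstyle\sum_{i=1}^n r_i\bigr): r_i\in\mathcal C_i,\ i=1,\dots,n\Bigr\},$$ and suppose that the maxima $$\rho=\max\Bigl\{\sqrt{\textstyle\sum_{i=1}^n\|r_i\|^2}: r_i\in\mathcal C_i\Bigr\},\qquad G=\max\Bigl\{\bigl\|\nabla U\bigl(\textstyle\sum_{i=1}^n r_i\bigr)\bigr\|: r_i\in\mathcal C_i\Bigr\}$$ exist. Let $\eta\ge1$, $\Delta>0$, $\epsilon>0$ (any $\Delta>0$ is allowed; in the private algorithm $\Delta$ is the $\ell_2$-sensitivity of the projections $\Pi_{\mathcal C_i}$ to admissible changes of $\mathcal C_i$). Consider the following algorithm with step sizes $\alpha_k=c/\sqrt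 k$ and weights $\theta_k=(\eta+1)/(\eta+k)$. Choose $r_1^{(1)},\dots,r_n^{(1)}\in\mathbb R^T$ arbitrarily and put $\hat r_i^{(1)}=r_i^{(1)}$. Let $w_1=0$ and let $w_2,\dots,w_K$ be independent random vectors in $\mathbb R^T$ with density proportional to $\exp\bigl(-\tfrac{2\epsilon\|w\|}{K(K-1)L\Delta}\bigr)$. For $k=1,\dots,K$ and $i=1,\dots,n$ let $$\hat p^{(k)}=\nabla U\bigl(\textstyle\sum_{l=1}^n r_l^{(k)}\bigr)+w_k,\qquad r_i^{(k+1)}=\Pi_{\mathcal C_i}\bigl(r_i^{(k)}-\alpha_k\hat p^{(k)}\bigr),\qquad \hat r_i^{(k+1)}=(1-\theta_k)\hat r_i^{(k)}+\theta_k r_i^{(k+1)}.$$ Put $\widehat G=\sqrt n\,\bigl(G+\tfrac{\sqrt2\,TK^2L\Delta}{2\epsilon}\bigr)$. Then there is a universal constant $A>0$ (depending on none of the above data) such that the suboptimality $U(\sum_i\hat r_i^{(K+1)})-U^*$ is integrable and, for every $c>0$, $$\mathbb E\Bigl[U\bigl(\textstyle\sum_{i=1}^n\hat r_i^{(K+1)}\bigr)-U^*\Bigr]\le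 A\,\frac{\eta\,(\rho^2/c+c\,\widehat G^2)}{\sqrt K},$$ and for the choice $c=\rho/\widehat G$ (read as $0$ when $\widehat G=0$), $$\mathbb E\Bigl[U\bigl(\textstyle\sum_{i=1}^n\hat r_i^{(K+1)}\bigr)-U^*\Bigr]\le A\,\eta\sqrt n\,\rho\left(\frac{G}{\sqrt K}+\frac{\sqrt2\,TK^{3/2}L\Delta}{2\epsilon}\right).$$ -/

import Mathlib

open MeasureTheory ProbabilityTheory

namespace DPGD

/-- The space `ℝ^T` with the Euclidean norm. -/
abbrev Vec (T : ℕ) : Type := EuclideanSpace ℝ (Fin T)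

/-- The Euclidean projection of `x` onto `C`: the minimizer of `‖y - x‖` over `y ∈ C`
(it exists and is unique when `C` is nonempty, closed and convex). -/
noncomputable def proj {T : ℕ} (C : Set (Vec T)) (x : Vec T) : Vec T :=
  Classical.epsilon fun y => y ∈ C ∧ ∀ z ∈ C, ‖y - x‖ ≤ ‖z - x‖

/-- The feasible set `{(r_1, …, r_n) : r_i ∈ C_i}`. -/
def feasible {n T : ℕ} (C : Fin n → Set (Vec T)) : Set (Fin n → Vec T) :=
  {r | ∀ i, r i ∈ C i}

/-- The optimal value of the problem: minimize `U (∑ i, r_i)` subject to `r_i ∈ C_i`. -/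
noncomputable def optVal {n T : ℕ} (U : Vec T → ℝ) (C : Fin n → Set (Vec T)) : ℝ :=
  sInf ((fun r : Fin n → Vec T => U (∑ i, r i)) '' feasible C)

/-- The set of all values `√(∑ i, ‖r_i‖²)` with `r_i ∈ C_i`. -/
def feasNorms {n T : ℕ} (C : Fin n → Set (Vec T)) : Set ℝ :=
  (fun r : Fin n → Vec T => Real.sqrt (∑ i, ‖r i‖ ^ 2)) '' feasible C

/-- The set of all values `‖∇U (∑ i, r_i)‖` with `r_i ∈ C_i`. -/
def feasGradNorms {n T : ℕ} (U : Vec T → ℝ) (C : Fin n → Set (Vec T)) : Set ℝ :=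
  (fun r : Fin n → Vec T => ‖gradient U (∑ i, r i)‖) '' feasible C

/-- The unnormalized noise measure on `ℝ^T`, with Lebesgue density
`exp (- 2 ε ‖w‖ / (K (K - 1) L Δ))`. -/
noncomputable def noiseDensityMeasure (T K : ℕ) (L Δ ε : ℝ) : Measure (Vec T) :=
  (volume : Measure (Vec T)).withDensity fun w =>
    ENNReal.ofReal (Real.exp (-(2 * ε * ‖w‖ / ((K : ℝ) * ((K : ℝ) - 1) * L * Δ))))

/-- The noise distribution: the probability measure on `ℝ^T` whose density is proportional to
`exp (- 2 ε ‖w‖ / (K (K - 1) L Δ))`. -/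
noncomputable def noiseLaw (T K : ℕ) (L Δ ε : ℝ) : Measure (Vec T) :=
  (noiseDensityMeasure T K L Δ ε Set.univ)⁻¹ • noiseDensityMeasure T K L Δ ε

/-- The noise vectors `w_1, …, w_K` of the algorithm: `w_1 = 0`, each `w_k` with `2 ≤ k ≤ K` is
drawn from `noiseLaw`, and the draws are independent. -/
structure IsNoise {Ω : Type*} [MeasurableSpace Ω] (μ : Measure Ω) (T K : ℕ) (L Δ ε : ℝ)
    (w : ℕ → Ω → Vec T) : Prop where
  measurable : ∀ k ∈ Finset.Icc 1 K, Measurable (w k)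
  first_eq_zero : ∀ ω, w 1 ω = 0
  law : ∀ k ∈ Finset.Icc 2 K, μ.map (w k) = noiseLaw T K L Δ ε
  indep : iIndepFun (fun k : Finset.Icc 1 K => w k) μ

/-- The iterates: `iter U C α w r₁ j` is `(r_1^(j+1), …, r_n^(j+1))`, started at `r^(1) = r₁`, with
`r_i^(k+1) = Π_{C_i} (r_i^(k) - α_k p̂^(k))` and `p̂^(k) = ∇U (∑ i, r_i^(k)) + w_k`. -/
noncomputable def iter {n T : ℕ} (U : Vec T → ℝ) (C : Fin n → Set (Vec T)) (α : ℕ → ℝ)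
    (w : ℕ → Vec T) (r₁ : Fin n → Vec T) : ℕ → Fin n → Vec T
  | 0 => r₁
  | j + 1 => fun i =>
      proj (C i) (iter U C α w r₁ j i -
        α (j + 1) • (gradient U (∑ l, iter U C α w r₁ j l) + w (j + 1)))

/-- The averaging weights `θ_k = (η + 1) / (η + k)`. -/
noncomputable def avgWeight (η : ℝ) (k : ℕ) : ℝ := (η + 1) / (η + k)

/-- The averaged iterates: `avgIter U C α η w r₁ j` is `(r̂_1^(j+1), …, r̂_n^(j+1))`, with
`r̂^(1) = r^(1)` and `r̂_i^(k+1) = (1 - θ_k) r̂_i^(k) + θ_k r_i^(k+1)`. -/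
noncomputable def avgIter {n T : ℕ} (U : Vec T → ℝ) (C : Fin n → Set (Vec T)) (α : ℕ → ℝ)
    (η : ℝ) (w : ℕ → Vec T) (r₁ : Fin n → Vec T) : ℕ → Fin n → Vec T
  | 0 => r₁
  | j + 1 => fun i =>
      (1 - avgWeight η (j + 1)) • avgIter U C α η w r₁ j i +
        avgWeight η (j + 1) • iter U C α w r₁ (j + 1) i

/-- The suboptimality `U (∑ i, r̂_i^(K+1)) - U*` of the output of the `K`-step algorithm with step
sizes `α_k = c / √k`, averaging parameter `η`, noise `w` and initial point `r₁`. -/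
noncomputable def subopt {n T : ℕ} (U : Vec T → ℝ) (C : Fin n → Set (Vec T)) (K : ℕ) (c η : ℝ)
    (w : ℕ → Vec T) (r₁ : Fin n → Vec T) : ℝ :=
  U (∑ i, avgIter U C (fun k => c / Real.sqrt k) η w r₁ K i) - optVal U C

/-- The constant `√n (G + √2 T K² L Δ / (2 ε))` that bounds the root mean square norm of the
stochastic gradient. -/
noncomputable def gradConst (n T K : ℕ) (G L Δ ε : ℝ) : ℝ :=
  Real.sqrt n * (G + Real.sqrt 2 * T * (K : ℝ) ^ 2 * L * Δ / (2 * ε))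

end DPGD

/-! The proof is a projected-gradient distance argument, run in expectation and combined with
averaging. Fix a feasible `z` and let `D_k = ∑ ‖r_i^(k) - z_i‖²`. Nonexpansive projections and the
first-order convexity bound make `2 α_k (U(r^(k)) - U(z))` at most `D_k - D_{k+1} + α_k² n (G +
‖w_k‖)²` minus a term linear in `w_k` (`descent_step`). In expectation the linear term vanishes,
since `w_k` is centred and independent of `r^(k)` (`indepFun_iter`), and the quadratic one is at
most `α_k² Ĝ²` by the second moment of the noise (`expected_descent_step`).

This works for `2 ≤ k ≤ K` only: `r^(1)` may be infeasible, so `G` need not bound its gradient, and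
no step follows `r^(K+1)`. The start is harmless because `θ_1 = 1` erases it from the average. The
last iterate is controlled by the oscillation of `U` over the feasible set, at most `2 √n ρ G`, and
enters with weight `θ_K = O(η / K)` (`last_step_bound`). In between, convexity turns averaging into
a scalar recursion, solved by a potential that carries a multiple of the current `D_k`
(`error_recursion`).

The bound holds against every feasible `z`, hence against the infimum. The Lipschitz condition
serves only to make the gradient continuous, for measurability. -/

namespace DPGD

/-! ### Euclidean projections. -/

section Projection

variable {T : ℕ} {C : Set (Vec T)}

lemma exists_isNearest (hc : Convex ℝ C) (hcl : IsClosed C) (hne : C.Nonempty) (x : Vec T) :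
    ∃ y, y ∈ C ∧ ∀ z ∈ C, ‖y - x‖ ≤ ‖z - x‖ := by
  obtain ⟨v, hv, h⟩ := exists_norm_eq_iInf_of_complete_convex hne hcl.isComplete hc x
  refine ⟨v, hv, fun z hz => ?_⟩
  rw [norm_sub_rev v, norm_sub_rev z, h]
  exact ciInf_le (f := fun w : C => ‖x - w‖) ⟨0, by rintro _ ⟨w, rfl⟩; positivity⟩ ⟨z, hz⟩

lemma proj_spec (hc : Convex ℝ C) (hcl : IsClosed C) (hne : C.Nonempty) (x : Vec T) :
    proj C x ∈ C ∧ ∀ z ∈ C, ‖proj C x - x‖ ≤ ‖z - x‖ :=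
  Classical.epsilon_spec (exists_isNearest hc hcl hne x)

lemma inner_sub_proj_nonpos (hc : Convex ℝ C) (hcl : IsClosed C) (hne : C.Nonempty) (x : Vec T)
    {z : Vec T} (hz : z ∈ C) : inner ℝ (x - proj C x) (z - proj C x) ≤ 0 := by
  obtain ⟨hm, hmin⟩ := proj_spec hc hcl hne x
  refine (norm_eq_iInf_iff_real_inner_le_zero hc hm).1 ?_ z hz
  have : Nonempty C := hne.to_subtype
  refine le_antisymm (le_ciInf fun w => ?_)
    (ciInf_le (f := fun w : C => ‖x - w‖) ⟨0, by rintro _ ⟨w, rfl⟩; positivity⟩ ⟨_, hm⟩)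
  rw [norm_sub_rev x, norm_sub_rev x]
  exact hmin w w.2

/-- Adding the variational inequalities at the two projections gives firm nonexpansiveness, and
Cauchy–Schwarz finishes. -/
lemma norm_proj_sub_proj_le (hc : Convex ℝ C) (hcl : IsClosed C) (hne : C.Nonempty) (x y : Vec T) :
    ‖proj C x - proj C y‖ ≤ ‖x - y‖ := by
  have h1 := inner_sub_proj_nonpos hc hcl hne x (proj_spec hc hcl hne y).1
  have h2 := inner_sub_proj_nonpos hc hcl hne y (proj_spec hc hcl hne x).1
  set p := proj C x
  set q := proj C y
  have h3 : ‖p - q‖ ^ 2 ≤ inner ℝ (x - y) (p - q) := by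
    have e : inner ℝ (x - y) (p - q) - inner ℝ (p - q) (p - q)
        = -(inner ℝ (x - p) (q - p) + inner ℝ (y - q) (p - q)) := by
      rw [← inner_sub_left, ← neg_sub p q, inner_neg_right, neg_add, neg_neg, ← sub_eq_add_neg,
        ← inner_sub_left]
      congr 1
      abel
    rw [← real_inner_self_eq_norm_sq]
    linarith
  have h4 := real_inner_le_norm (x - y) (p - q)
  by_contra! h
  nlinarith [norm_nonneg (x - y), norm_nonneg (p - q)]

lemma continuous_proj (hc : Convex ℝ C) (hcl : IsClosed C) (hne : C.Nonempty) :
    Continuous (proj C) := by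
  refine (LipschitzWith.of_dist_le_mul (K := 1) fun x y => ?_).continuous
  simpa [dist_eq_norm] using norm_proj_sub_proj_le hc hcl hne x y

lemma proj_eq_self (hc : Convex ℝ C) (hcl : IsClosed C) {z : Vec T} (hz : z ∈ C) :
    proj C z = z := by
  have := (proj_spec hc hcl ⟨z, hz⟩ z).2 z hz
  rw [sub_self, norm_zero] at this
  exact sub_eq_zero.1 (norm_le_zero_iff.1 this)

lemma norm_proj_sub_le (hc : Convex ℝ C) (hcl : IsClosed C) {z : Vec T} (hz : z ∈ C) (x : Vec T) :
    ‖proj C x - z‖ ≤ ‖x - z‖ := by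
  simpa only [proj_eq_self hc hcl hz] using norm_proj_sub_proj_le hc hcl ⟨z, hz⟩ x z

end Projection

/-! ### Convexity along segments and the scalar error recursion. -/

/-- The first-order lower bound of a differentiable convex function. -/
lemma sub_le_inner_gradient {E : Type*} [NormedAddCommGroup E] [InnerProductSpace ℝ E]
    [CompleteSpace E] {U : E → ℝ} (hd : Differentiable ℝ U) (hU : ConvexOn ℝ Set.univ U) (x z : E) :
    U x - U z ≤ inner ℝ (gradient U x) (x - z) := by
  have hg : HasDerivAt (fun t : ℝ => U (x + t • (z - x))) (inner ℝ (gradient U x) (z - x)) 0 := by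
    have h1 : HasDerivAt (fun t : ℝ => x + t • (z - x)) (z - x) 0 := by
      simpa using ((hasDerivAt_id (0 : ℝ)).smul_const (z - x)).const_add x
    have h2 : HasFDerivAt U (InnerProductSpace.toDual ℝ E (gradient U x)) (x + (0 : ℝ) • (z - x)) := by
      simpa using (hd x).hasGradientAt.hasFDerivAt
    exact h2.comp_hasDerivAt (0 : ℝ) h1
  have hc : ConvexOn ℝ Set.univ (fun t : ℝ => U (x + t • (z - x))) := by
    refine ⟨convex_univ, fun s _ t _ a b ha hb hab => ?_⟩
    have := hU.2 (Set.mem_univ (x + s • (z - x))) (Set.mem_univ (x + t • (z - x))) ha hb hab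
    convert this using 2
    have : x = (a + b) • x := by rw [hab, one_smul]
    nth_rewrite 1 [this]
    simp only [smul_eq_mul]
    module
  have := hc.le_slope_of_hasDerivAt (Set.mem_univ 0) (Set.mem_univ 1) one_pos hg
  simp only [slope, sub_zero, inv_one, one_smul, zero_smul, add_zero, vsub_eq_sub,
    add_sub_cancel] at this
  rw [← neg_sub z x, inner_neg_right]
  linarith

/-- The weighted error of a descent recursion with step sizes `c / √k` and averaging weights
`avgWeight η k`. -/
lemma error_recursion {η c V R : ℝ} (hη : 1 ≤ η) (hc : 0 < c) (hV : 0 ≤ V) {K : ℕ}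
    {e d h : ℕ → ℝ}
    (he : ∀ k, k + 1 < K → e (k + 1) ≤ (1 - avgWeight η (k + 1)) * e k + avgWeight η (k + 1) * h (k + 1))
    (hh : ∀ k, k + 1 < K → h (k + 1) ≤
      √((k : ℝ) + 2) * (d (k + 1) - d (k + 2)) / (2 * c) + c * V / (2 * √((k : ℝ) + 2)))
    (hd : ∀ k, d (k + 1) ≤ R) (k : ℕ) (hk : k + 1 < K) :
    e (k + 1) + avgWeight η (k + 1) * √((k : ℝ) + 2) * d (k + 2) / (2 * c) ≤
      avgWeight η (k + 1) * √((k : ℝ) + 2) * R / (2 * c) + c * V / √((k : ℝ) + 1) := by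
  induction k with
  | zero =>
    have h0 := he 0 hk
    have h1 := hh 0 hk
    -- The first weight is 1, so the uncontrolled initial error `e 0` drops out.
    have hw : avgWeight η (0 + 1) = 1 := by
      simp only [avgWeight, zero_add, Nat.cast_one]
      exact div_self (by positivity)
    rw [hw] at h0 ⊢
    have h2 : c * V / (2 * √(((0 : ℕ) : ℝ) + 2)) ≤ c * V / √(((0 : ℕ) : ℝ) + 1) := by
      apply div_le_div_of_nonneg_left (by positivity) (by simp)
      have : (1 : ℝ) ≤ √2 := Real.one_le_sqrt.2 (by norm_num)
      simp
      linarith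
    have h3 : √(((0 : ℕ) : ℝ) + 2) * d (0 + 1) / (2 * c) ≤ √(((0 : ℕ) : ℝ) + 2) * R / (2 * c) := by
      have := hd 0
      gcongr
    have h4 : √(((0 : ℕ) : ℝ) + 2) * (d (0 + 1) - d (0 + 2)) / (2 * c) =
      √(((0 : ℕ) : ℝ) + 2) * d (0 + 1) / (2 * c) - √(((0 : ℕ) : ℝ) + 2) * d (0 + 2) / (2 * c) := by
      ring
    simp only [Nat.cast_zero, zero_add, one_mul, sub_self, zero_mul] at *
    linarith
  | succ k ih =>
    have ih := ih (by omega)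
    have h0 := he (k + 1) hk
    have h1 := hh (k + 1) hk
    have h2 := hd (k + 1)
    have hw1 : avgWeight η (k + 1) = (η + 1) / (η + (k + 1)) := by simp [avgWeight]
    have hw2 : avgWeight η (k + 1 + 1) = (η + 1) / (η + (k + 2)) := by
      simp [avgWeight]; ring
    have hkk : (0 : ℝ) ≤ k := Nat.cast_nonneg k
    push_cast at h0 h1 ⊢
    rw [show (k : ℝ) + 1 + 1 = k + 2 by ring, show (k : ℝ) + 1 + 2 = k + 3 by ring] at *
    rw [show k + 1 + 1 = k + 2 by ring, show k + 1 + 2 = k + 3 by ring] at *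
    set θ := avgWeight η (k + 1)
    set θ' := avgWeight η (k + 2)
    have hθ : 0 ≤ θ := by rw [hw1]; positivity
    have hθ' : 0 ≤ θ' := by rw [hw2]; positivity
    have hθ1 : 1 - θ' = (k + 1) / (η + (k + 2)) := by rw [hw2]; field_simp; ring
    have hθ1' : 0 ≤ 1 - θ' := by rw [hθ1]; positivity
    -- Together with the growth of the square roots, this makes the coefficient of `d` in the
    -- potential at least as large as the discounted previous one.
    have hmono : (1 - θ') * θ ≤ θ' := by
      rw [hθ1, hw1, hw2, div_mul_div_comm, div_le_div_iff₀ (by positivity) (by positivity)]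
      have : 0 ≤ (η + 1) * (η + (k + 2)) := by positivity
      nlinarith
    have hs : √((k : ℝ) + 2) ≤ √((k : ℝ) + 3) := Real.sqrt_le_sqrt (by linarith)
    have hcoef : (1 - θ') * (θ * √((k : ℝ) + 2)) ≤ θ' * √((k : ℝ) + 3) := by
      rw [← mul_assoc]
      exact mul_le_mul hmono hs (Real.sqrt_nonneg _) hθ'
    -- The gradient-norm contribution keeps the form `c V / √·` because `√(k+1) √(k+2) ≤ k + 3/2` by
    -- AM–GM.
    have hnoise : (1 - θ') * (c * V / √((k : ℝ) + 1)) + θ' * (c * V / (2 * √((k : ℝ) + 3))) ≤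
        c * V / √((k : ℝ) + 2) := by
      have hA : (1 - θ') * (1 / √((k : ℝ) + 1)) + θ' * (1 / (2 * √((k : ℝ) + 3))) ≤
          1 / √((k : ℝ) + 2) := by
        have s1 : 0 < √((k : ℝ) + 1) := by positivity
        have s2 : 0 < √((k : ℝ) + 2) := by positivity
        have q1 : √((k : ℝ) + 1) ^ 2 = k + 1 := Real.sq_sqrt (by positivity)
        have q2 : √((k : ℝ) + 2) ^ 2 = k + 2 := Real.sq_sqrt (by positivity)
        have a1 : 1 / (2 * √((k : ℝ) + 3)) ≤ 1 / (2 * √((k : ℝ) + 2)) := by gcongr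
        have a2 : (1 - θ') * (1 / √((k : ℝ) + 1)) = √((k : ℝ) + 1) / (η + (k + 2)) := by
          rw [hθ1, div_mul_div_comm, div_eq_div_iff (by positivity) (by positivity)]
          linear_combination (-(η + (k + 2))) * q1
        have a3 : √((k : ℝ) + 1) * √((k : ℝ) + 2) ≤ k + 3 / 2 := by
          nlinarith [sq_nonneg (√((k : ℝ) + 1) - √((k : ℝ) + 2))]
        rw [a2]
        refine (add_le_add_right (mul_le_mul_of_nonneg_left a1 hθ') _).trans ?_
        rw [hw2]
        have : √((k : ℝ) + 1) / (η + (k + 2)) + (η + 1) / (η + (k + 2)) * (1 / (2 * √((k : ℝ) + 2))) =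
            (√((k : ℝ) + 1) * √((k : ℝ) + 2) + (η + 1) / 2) / ((η + (k + 2)) * √((k : ℝ) + 2)) := by
          field_simp
        rw [this, div_le_div_iff₀ (by positivity) s2, one_mul]
        exact mul_le_mul_of_nonneg_right (by linarith) s2.le
      calc _ = c * V * ((1 - θ') * (1 / √((k : ℝ) + 1)) + θ' * (1 / (2 * √((k : ℝ) + 3)))) := by
            ring
        _ ≤ c * V * (1 / √((k : ℝ) + 2)) := mul_le_mul_of_nonneg_left hA (by positivity)
        _ = _ := by ring
    have m1 := mul_le_mul_of_nonneg_left ih hθ1'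
    have m2 := mul_le_mul_of_nonneg_left h1 hθ'
    -- Abel summation: the part of the new coefficient of `d (k + 2)` not absorbed by the old
    -- potential is nonnegative, so there `d` may be replaced by `R`.
    have m3 : 0 ≤ (θ' * √((k : ℝ) + 3) - (1 - θ') * (θ * √((k : ℝ) + 2))) * (R - d (k + 2)) / (2 * c) := by
      have := mul_nonneg (sub_nonneg.2 hcoef) (sub_nonneg.2 h2)
      positivity
    have e1 : θ' * √((k : ℝ) + 3) * R / (2 * c) =
        (θ' * √((k : ℝ) + 3) - (1 - θ') * (θ * √((k : ℝ) + 2))) * (R - d (k + 2)) / (2 * c)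
        + θ' * √((k : ℝ) + 3) * d (k + 2) / (2 * c)
        + (1 - θ') * (θ * √((k : ℝ) + 2) * R / (2 * c))
        - (1 - θ') * (θ * √((k : ℝ) + 2) * d (k + 2) / (2 * c)) := by ring
    rw [e1]
    have e2 : θ' * (√((k : ℝ) + 3) * (d (k + 2) - d (k + 3)) / (2 * c) + c * V / (2 * √((k : ℝ) + 3)))
      = θ' * √((k : ℝ) + 3) * d (k + 2) / (2 * c) - θ' * √((k : ℝ) + 3) * d (k + 3) / (2 * c)
       + θ' * (c * V / (2 * √((k : ℝ) + 3))) := by ring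
    rw [e2] at m2
    linarith

/-! ### Moments of the noise law, by polar coordinates. -/

lemma integral_Ioi_pow_mul_exp_neg_mul (m : ℕ) {b : ℝ} (hb : 0 < b) :
    ∫ y in Set.Ioi (0 : ℝ), y ^ m * Real.exp (-(b * y)) = (1 / b) ^ (m + 1) * m.factorial := by
  have h := Real.integral_rpow_mul_exp_neg_mul_Ioi (a := (m : ℝ) + 1) (r := b) (by positivity) hb
  rw [Real.Gamma_nat_eq_factorial, ← Nat.cast_add_one, Real.rpow_natCast] at h
  rw [← h]
  refine setIntegral_congr_fun measurableSet_Ioi fun y _ => ?_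
  simp

lemma integrableOn_Ioi_pow_mul_exp_neg_mul (m : ℕ) {b : ℝ} (hb : 0 < b) :
    IntegrableOn (fun y : ℝ => y ^ m * Real.exp (-(b * y))) (Set.Ioi 0) := by
  -- The Bochner integral of a nonintegrable function is 0 by convention, so a nonzero value proves
  -- integrability.
  refine Integrable.of_integral_ne_zero ?_
  rw [integral_Ioi_pow_mul_exp_neg_mul m hb]
  positivity

lemma integrable_norm_pow_mul_exp {T : ℕ} (m : ℕ) {b : ℝ} (hb : 0 < b) :
    Integrable (fun x : Vec T => ‖x‖ ^ m * Real.exp (-(b * ‖x‖))) := by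
  rcases Nat.eq_zero_or_pos T with rfl | hT
  · have : IsFiniteMeasure (volume : Measure (Vec 0)) :=
      ⟨by simp⟩
    exact Integrable.of_finite
  · have : NeZero T := ⟨hT.ne'⟩
    refine (integrable_fun_norm_addHaar (volume : Measure (Vec T))
      (f := fun y => y ^ m * Real.exp (-(b * y)))).2 ?_
    refine (integrableOn_Ioi_pow_mul_exp_neg_mul (T - 1 + m) hb).congr_fun (fun y _ => ?_)
      measurableSet_Ioi
    simp [pow_add, mul_assoc]

/-- The second moment of the density `exp (-b ‖x‖)` relative to its mass. -/
lemma integral_norm_sq_mul_exp {T : ℕ} {b : ℝ} (hb : 0 < b) :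
    ∫ x : Vec T, ‖x‖ ^ 2 * Real.exp (-(b * ‖x‖)) =
      T * (T + 1) / b ^ 2 * ∫ x : Vec T, Real.exp (-(b * ‖x‖)) := by
  rcases Nat.eq_zero_or_pos T with rfl | hT
  · have h (x : Vec 0) : ‖x‖ = 0 := by rw [Subsingleton.elim x 0, norm_zero]
    simp [h]
  · have : NeZero T := ⟨hT.ne'⟩
    rw [integral_fun_norm_addHaar (volume : Measure (Vec T))
      (fun y => y ^ 2 * Real.exp (-(b * y))),
      integral_fun_norm_addHaar (volume : Measure (Vec T)) (fun y => Real.exp (-(b * y)))]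
    obtain ⟨m, rfl⟩ : ∃ m, T = m + 1 := ⟨T - 1, by omega⟩
    simp only [finrank_euclideanSpace, Fintype.card_fin, add_tsub_cancel_right, smul_eq_mul,
      nsmul_eq_mul, ← mul_assoc, ← pow_add]
    rw [integral_Ioi_pow_mul_exp_neg_mul _ hb, integral_Ioi_pow_mul_exp_neg_mul _ hb,
      Nat.factorial_succ, Nat.factorial_succ]
    push_cast
    simp only [one_div, inv_pow, pow_add]
    field_simp

/-- The rate is abstracted to a positive `b` through `hbe`; this form rewrites directly inside the
density and isolates the only place where `K ≥ 2` matters, namely `b > 0`. -/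
lemma noiseDensityMeasure_univ {T K : ℕ} {L Δ ε b : ℝ} (hb : 0 < b)
    (hbe : ∀ x : ℝ, 2 * ε * x / ((K : ℝ) * ((K : ℝ) - 1) * L * Δ) = b * x) :
    noiseDensityMeasure T K L Δ ε Set.univ =
      ENNReal.ofReal (∫ x : Vec T, Real.exp (-(b * ‖x‖))) ∧
    0 < ∫ x : Vec T, Real.exp (-(b * ‖x‖)) := by
  have hi : Integrable (fun x : Vec T => Real.exp (-(b * ‖x‖))) := by
    simpa using integrable_norm_pow_mul_exp (T := T) 0 hb
  refine ⟨?_, integral_exp_pos hi⟩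
  rw [noiseDensityMeasure, withDensity_apply _ MeasurableSet.univ, Measure.restrict_univ,
    ofReal_integral_eq_lintegral_ofReal hi (Filter.Eventually.of_forall fun x => (Real.exp_pos _).le)]
  simp only [hbe]

lemma integral_noiseLaw {E : Type*} [NormedAddCommGroup E] [NormedSpace ℝ E]
    {T K : ℕ} {L Δ ε b : ℝ} (hb : 0 < b)
    (hbe : ∀ x : ℝ, 2 * ε * x / ((K : ℝ) * ((K : ℝ) - 1) * L * Δ) = b * x) (f : Vec T → E) :
    ∫ x, f x ∂noiseLaw T K L Δ ε =
      (∫ x : Vec T, Real.exp (-(b * ‖x‖)))⁻¹ • ∫ x, Real.exp (-(b * ‖x‖)) • f x := by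
  obtain ⟨h1, h2⟩ := noiseDensityMeasure_univ (T := T) hb hbe
  rw [noiseLaw, integral_smul_measure, h1, ENNReal.toReal_inv, ENNReal.toReal_ofReal h2.le,
    noiseDensityMeasure]
  simp only [hbe]
  rw [integral_withDensity_eq_integral_toReal_smul (by fun_prop) (by simp)]
  simp only [ENNReal.toReal_ofReal (Real.exp_pos _).le]

lemma integrable_noiseLaw {T K : ℕ} {L Δ ε b : ℝ} (hb : 0 < b)
    (hbe : ∀ x : ℝ, 2 * ε * x / ((K : ℝ) * ((K : ℝ) - 1) * L * Δ) = b * x) {f : Vec T → ℝ}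
    (hf : Integrable (fun x => Real.exp (-(b * ‖x‖)) * f x)) :
    Integrable f (noiseLaw T K L Δ ε) := by
  obtain ⟨h1, h2⟩ := noiseDensityMeasure_univ (T := T) hb hbe
  refine Integrable.smul_measure ?_ (by simp [h1, h2])
  rw [noiseDensityMeasure]
  simp only [hbe]
  rw [integrable_withDensity_iff_integrable_smul' (by fun_prop) (by simp)]
  simpa only [ENNReal.toReal_ofReal (Real.exp_pos _).le, smul_eq_mul] using hf

lemma integrable_norm_pow_noiseLaw {T K : ℕ} {L Δ ε b : ℝ} (hb : 0 < b)
    (hbe : ∀ x : ℝ, 2 * ε * x / ((K : ℝ) * ((K : ℝ) - 1) * L * Δ) = b * x) (m : ℕ) :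
    Integrable (fun x : Vec T => ‖x‖ ^ m) (noiseLaw T K L Δ ε) :=
  integrable_noiseLaw hb hbe (by simpa only [mul_comm] using integrable_norm_pow_mul_exp m hb)

lemma integral_noiseLaw_norm_sq {T K : ℕ} {L Δ ε b : ℝ} (hb : 0 < b)
    (hbe : ∀ x : ℝ, 2 * ε * x / ((K : ℝ) * ((K : ℝ) - 1) * L * Δ) = b * x) :
    ∫ x : Vec T, ‖x‖ ^ 2 ∂noiseLaw T K L Δ ε = T * (T + 1) / b ^ 2 := by
  have h2 := (noiseDensityMeasure_univ (T := T) hb hbe).2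
  rw [integral_noiseLaw hb hbe]
  simp only [smul_eq_mul]
  simp_rw [mul_comm (Real.exp _)]
  rw [integral_norm_sq_mul_exp hb]
  field_simp

lemma integral_noiseLaw_id {T K : ℕ} {L Δ ε b : ℝ} (hb : 0 < b)
    (hbe : ∀ x : ℝ, 2 * ε * x / ((K : ℝ) * ((K : ℝ) - 1) * L * Δ) = b * x) :
    ∫ x : Vec T, x ∂noiseLaw T K L Δ ε = 0 := by
  rw [integral_noiseLaw hb hbe]
  -- The density is even, so the first moment equals its own negative.
  have h := integral_neg_eq_self (fun x : Vec T => Real.exp (-(b * ‖x‖)) • x) volume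
  simp only [norm_neg, smul_neg, integral_neg] at h
  have h0 : (2 : ℝ) • ∫ x : Vec T, Real.exp (-(b * ‖x‖)) • x = 0 := by
    rw [two_smul]
    nth_rewrite 1 [← h]
    exact neg_add_cancel _
  rw [(smul_eq_zero.1 h0).resolve_left two_ne_zero, smul_zero]

end DPGD

/-! ### Geometry of the feasible set, the pathwise descent step, and independence. -/

namespace DPGD

variable {n T : ℕ} {U : Vec T → ℝ} {C : Fin n → Set (Vec T)} {α : ℕ → ℝ} {r₁ : Fin n → Vec T}
  {ρ G : ℝ}

lemma norm_sum_sq_le (x : Fin n → Vec T) : ‖∑ i, x i‖ ^ 2 ≤ n * ∑ i, ‖x i‖ ^ 2 := by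
  have h := sq_sum_le_card_mul_sum_sq (s := Finset.univ) (f := fun i => ‖x i‖)
  rw [Finset.card_univ, Fintype.card_fin] at h
  exact (pow_le_pow_left₀ (norm_nonneg _) (norm_sum_le _ _) 2).trans h

lemma sum_norm_sq_le_of_mem_feasible (hρ : IsGreatest (feasNorms C) ρ) {x : Fin n → Vec T}
    (hx : x ∈ feasible C) : ∑ i, ‖x i‖ ^ 2 ≤ ρ ^ 2 := by
  have h := hρ.2 ⟨x, hx, rfl⟩
  exact (Real.sqrt_le_left ((Real.sqrt_nonneg _).trans h)).1 h

lemma nonneg_of_isGreatest_feasNorms (hρ : IsGreatest (feasNorms C) ρ) : 0 ≤ ρ := by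
  obtain ⟨x, -, rfl⟩ := hρ.1
  exact Real.sqrt_nonneg _

lemma nonneg_of_isGreatest_feasGradNorms (hG : IsGreatest (feasGradNorms U C) G) : 0 ≤ G := by
  obtain ⟨x, -, rfl⟩ := hG.1
  exact norm_nonneg _

lemma sum_norm_sub_sq_le (hρ : IsGreatest (feasNorms C) ρ) {x z : Fin n → Vec T}
    (hx : x ∈ feasible C) (hz : z ∈ feasible C) : ∑ i, ‖x i - z i‖ ^ 2 ≤ 4 * ρ ^ 2 := by
  have h1 := sum_norm_sq_le_of_mem_feasible hρ hx
  have h2 := sum_norm_sq_le_of_mem_feasible hρ hz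
  have h3 : ∑ i, ‖x i - z i‖ ^ 2 ≤ ∑ i, (2 * ‖x i‖ ^ 2 + 2 * ‖z i‖ ^ 2) := by
    refine Finset.sum_le_sum fun i _ => ?_
    have := pow_le_pow_left₀ (norm_nonneg _) (norm_sub_le (x i) (z i)) 2
    nlinarith [sq_nonneg (‖x i‖ - ‖z i‖)]
  rw [Finset.sum_add_distrib, ← Finset.mul_sum, ← Finset.mul_sum] at h3
  linarith

lemma norm_sum_sub_le (hρ : IsGreatest (feasNorms C) ρ) {x z : Fin n → Vec T}
    (hx : x ∈ feasible C) (hz : z ∈ feasible C) : ‖∑ i, (x i - z i)‖ ≤ 2 * √n * ρ := by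
  have h0 := nonneg_of_isGreatest_feasNorms hρ
  refine abs_le_of_sq_le_sq' ?_ (by positivity) |>.2
  have h1 := mul_le_mul_of_nonneg_left (sum_norm_sub_sq_le hρ hx hz) (Nat.cast_nonneg' (α := ℝ) n)
  refine (norm_sum_sq_le fun i => x i - z i).trans (h1.trans_eq ?_)
  rw [mul_pow, mul_pow, Real.sq_sqrt (Nat.cast_nonneg n)]
  ring

/-- The gradient bound times the diameter of the set of sums. This oscillation bound gives
integrability, handles the last iterate, and settles the degenerate case of the theorem. -/
lemma sub_le_of_mem_feasible (hd : Differentiable ℝ U) (hU : ConvexOn ℝ Set.univ U)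
    (hρ : IsGreatest (feasNorms C) ρ) (hG : IsGreatest (feasGradNorms U C) G)
    {x z : Fin n → Vec T} (hx : x ∈ feasible C) (hz : z ∈ feasible C) :
    U (∑ i, x i) - U (∑ i, z i) ≤ 2 * √n * ρ * G := by
  have h0 := nonneg_of_isGreatest_feasNorms hρ
  refine (sub_le_inner_gradient hd hU _ _).trans ((real_inner_le_norm _ _).trans ?_)
  rw [← Finset.sum_sub_distrib, mul_comm]
  exact mul_le_mul (norm_sum_sub_le hρ hx hz) (hG.2 ⟨x, hx, rfl⟩) (norm_nonneg _) (by positivity)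

lemma abs_sub_le_of_mem_feasible (hd : Differentiable ℝ U) (hU : ConvexOn ℝ Set.univ U)
    (hρ : IsGreatest (feasNorms C) ρ) (hG : IsGreatest (feasGradNorms U C) G)
    {x z : Fin n → Vec T} (hx : x ∈ feasible C) (hz : z ∈ feasible C) :
    |U (∑ i, x i) - U (∑ i, z i)| ≤ 2 * √n * ρ * G :=
  abs_sub_le_iff.2 ⟨sub_le_of_mem_feasible hd hU hρ hG hx hz,
    sub_le_of_mem_feasible hd hU hρ hG hz hx⟩

lemma iter_succ_mem_feasible (hc : ∀ i, Convex ℝ (C i)) (hcl : ∀ i, IsClosed (C i))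
    (hne : ∀ i, (C i).Nonempty) (w : ℕ → Vec T) (j : ℕ) :
    iter U C α w r₁ (j + 1) ∈ feasible C :=
  fun i => (proj_spec (hc i) (hcl i) (hne i) _).1

lemma avgWeight_one {η : ℝ} (hη : 1 ≤ η) : avgWeight η 1 = 1 := by
  simp only [avgWeight, Nat.cast_one]
  exact div_self (by positivity)

lemma avgWeight_nonneg {η : ℝ} (hη : 1 ≤ η) (k : ℕ) : 0 ≤ avgWeight η k := by
  unfold avgWeight
  positivity

lemma avgWeight_succ_le_one {η : ℝ} (hη : 1 ≤ η) (k : ℕ) : avgWeight η (k + 1) ≤ 1 := by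
  unfold avgWeight
  rw [div_le_one (by positivity)]
  push_cast
  linarith [Nat.cast_nonneg (α := ℝ) k]

lemma avgIter_succ_mem_feasible (hc : ∀ i, Convex ℝ (C i)) (hcl : ∀ i, IsClosed (C i))
    (hne : ∀ i, (C i).Nonempty) {η : ℝ} (hη : 1 ≤ η) (w : ℕ → Vec T) (j : ℕ) :
    avgIter U C α η w r₁ (j + 1) ∈ feasible C := by
  induction j with
  | zero =>
    intro i
    simp only [avgIter, zero_add, avgWeight_one hη, sub_self, zero_smul, one_smul]
    exact iter_succ_mem_feasible hc hcl hne w 0 i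
  | succ j ih =>
    intro i
    exact hc i (ih i) (iter_succ_mem_feasible hc hcl hne w (j + 1) i)
      (sub_nonneg.2 (avgWeight_succ_le_one hη _)) (avgWeight_nonneg hη _) (sub_add_cancel _ _)

/-- Convexity along the averaging step. -/
lemma objective_avgIter_succ_le (hU : ConvexOn ℝ Set.univ U) {η : ℝ} (hη : 1 ≤ η) (w : ℕ → Vec T)
    (j : ℕ) :
    U (∑ i, avgIter U C α η w r₁ (j + 1) i) ≤
      (1 - avgWeight η (j + 1)) * U (∑ i, avgIter U C α η w r₁ j i) +
        avgWeight η (j + 1) * U (∑ i, iter U C α w r₁ (j + 1) i) := by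
  have h := hU.2 (Set.mem_univ (∑ i, avgIter U C α η w r₁ j i))
    (Set.mem_univ (∑ i, iter U C α w r₁ (j + 1) i))
    (sub_nonneg.2 (avgWeight_succ_le_one hη j)) (avgWeight_nonneg hη _) (sub_add_cancel _ _)
  simpa only [avgIter, Finset.sum_add_distrib, ← Finset.smul_sum, smul_eq_mul] using h

/-- The one-step descent inequality of projected gradient descent with a perturbed gradient. -/
lemma descent_step (hd : Differentiable ℝ U) (hU : ConvexOn ℝ Set.univ U)
    (hc : ∀ i, Convex ℝ (C i)) (hcl : ∀ i, IsClosed (C i))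
    (hG : IsGreatest (feasGradNorms U C) G) {x z : Fin n → Vec T} (hx : x ∈ feasible C)
    (hz : z ∈ feasible C) {a : ℝ} (ha : 0 ≤ a) (v : Vec T) :
    2 * a * (U (∑ i, x i) - U (∑ i, z i)) ≤
      ∑ i, ‖x i - z i‖ ^ 2 -
        ∑ i, ‖proj (C i) (x i - a • (gradient U (∑ l, x l) + v)) - z i‖ ^ 2 +
        a ^ 2 * (n * (G + ‖v‖) ^ 2) - 2 * a * inner ℝ v (∑ i, (x i - z i)) := by
  set p := gradient U (∑ l, x l) + v with hp
  have h1 : ∑ i, ‖proj (C i) (x i - a • p) - z i‖ ^ 2 ≤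
      ∑ i, (‖x i - z i‖ ^ 2 - 2 * a * inner ℝ p (x i - z i) + a ^ 2 * ‖p‖ ^ 2) := by
    refine Finset.sum_le_sum fun i _ => ?_
    refine (pow_le_pow_left₀ (norm_nonneg _)
      (norm_proj_sub_le (hc i) (hcl i) (hz i) (x i - a • p)) 2).trans_eq ?_
    rw [sub_right_comm, norm_sub_sq_real, inner_smul_right, norm_smul, mul_pow, Real.norm_eq_abs,
      sq_abs, real_inner_comm]
    ring
  rw [Finset.sum_add_distrib, Finset.sum_sub_distrib, ← Finset.mul_sum, ← inner_sum,
    Finset.sum_const, Finset.card_univ, Fintype.card_fin, nsmul_eq_mul] at h1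
  -- Feasibility of `x` is needed here: `G` bounds gradients only at feasible points.
  have h2 : ‖p‖ ^ 2 ≤ (G + ‖v‖) ^ 2 := by
    refine pow_le_pow_left₀ (norm_nonneg _) ((norm_add_le _ _).trans ?_) 2
    have := hG.2 ⟨x, hx, rfl⟩
    simp only at this
    gcongr
  have h3 : inner ℝ p (∑ i, (x i - z i)) =
      inner ℝ (gradient U (∑ l, x l)) (∑ i, (x i - z i)) + inner ℝ v (∑ i, (x i - z i)) := by
    rw [hp, inner_add_left]
  have h4 := sub_le_inner_gradient hd hU (∑ i, x i) (∑ i, z i)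
  rw [← Finset.sum_sub_distrib] at h4
  have h5 := mul_le_mul_of_nonneg_left h4 (mul_nonneg zero_le_two ha)
  have h6 := mul_le_mul_of_nonneg_left h2 (mul_nonneg (sq_nonneg a) (Nat.cast_nonneg (α := ℝ) n))
  rw [h3] at h1
  linarith

lemma iter_congr {w w' : ℕ → Vec T} {j : ℕ} (h : ∀ k ∈ Finset.Icc 1 j, w k = w' k) :
    iter U C α w r₁ j = iter U C α w' r₁ j := by
  induction j with
  | zero => rfl
  | succ j ih =>
    have ih := ih fun k hk => h k (by simp at hk ⊢; omega)
    funext i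
    simp only [iter, ih, h (j + 1) (by simp)]

lemma measurable_iter (hc : ∀ i, Convex ℝ (C i)) (hcl : ∀ i, IsClosed (C i))
    (hne : ∀ i, (C i).Nonempty) (hg : Continuous (gradient U)) {Ω : Type*} [MeasurableSpace Ω]
    {w : ℕ → Ω → Vec T} {j : ℕ} (hw : ∀ k ∈ Finset.Icc 1 j, Measurable (w k)) (i : Fin n) :
    Measurable fun ω => iter U C α (fun k => w k ω) r₁ j i := by
  induction j generalizing i with
  | zero => exact measurable_const
  | succ j ih =>
    have ih := ih fun k hk => hw k (by simp at hk ⊢; omega)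
    have h1 := hw (j + 1) (by simp)
    have h2 : Measurable fun ω => ∑ l, iter U C α (fun k => w k ω) r₁ j l :=
      Finset.measurable_sum _ fun l _ => ih l
    exact (continuous_proj (hc i) (hcl i) (hne i)).measurable.comp
      ((ih i).sub (((hg.measurable.comp h2).add h1).const_smul (α (j + 1))))

lemma measurable_avgIter (hc : ∀ i, Convex ℝ (C i)) (hcl : ∀ i, IsClosed (C i))
    (hne : ∀ i, (C i).Nonempty) (hg : Continuous (gradient U)) {η : ℝ} {Ω : Type*}
    [MeasurableSpace Ω] {w : ℕ → Ω → Vec T} {j : ℕ} (hw : ∀ k ∈ Finset.Icc 1 j, Measurable (w k))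
    (i : Fin n) : Measurable fun ω => avgIter U C α η (fun k => w k ω) r₁ j i := by
  induction j generalizing i with
  | zero => exact measurable_const
  | succ j ih =>
    have ih := ih fun k hk => hw k (by simp at hk ⊢; omega)
    exact ((ih i).const_smul (1 - avgWeight η (j + 1))).add
      ((measurable_iter hc hcl hne hg hw i).const_smul (avgWeight η (j + 1)))

/-- The `j`-th iterate is independent of the later noise vectors. -/
lemma indepFun_iter (hc : ∀ i, Convex ℝ (C i)) (hcl : ∀ i, IsClosed (C i))
    (hne : ∀ i, (C i).Nonempty) (hg : Continuous (gradient U)) {Ω : Type*} [MeasurableSpace Ω]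
    {μ : Measure Ω} {w : ℕ → Ω → Vec T} {K : ℕ} (hw : ∀ k ∈ Finset.Icc 1 K, Measurable (w k))
    (hi : iIndepFun (fun k : Finset.Icc 1 K => w k) μ) {j : ℕ} (hj : j < K)
    {φ : (Fin n → Vec T) → Vec T} (hφ : Measurable φ) :
    IndepFun (w (j + 1)) (fun ω => φ (iter U C α (fun k => w k ω) r₁ j)) μ := by
  classical
  let S : Finset (Finset.Icc 1 K) := {⟨j + 1, by simp; omega⟩}
  let S' : Finset (Finset.Icc 1 K) := Finset.univ.filter fun k => k.1 ≤ j
  have hS : Disjoint S S' := by simp [S, S']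
  have h := hi.indepFun_finset S S' hS fun k => hw k k.2
  -- Padding `w_1, …, w_j` by zeros exhibits the iterate as a measurable function of these vectors
  -- alone; `iter_congr` shows that the padding is never read.
  let ext : ℕ → (S' → Vec T) → Vec T := fun k v =>
    if hk : k ∈ Finset.Icc 1 j then
      v ⟨⟨k, by simp at hk ⊢; omega⟩, by simp at hk; simp [S', hk.2]⟩ else 0
  have hext : ∀ k, Measurable (ext k) := by
    intro k
    by_cases hk : k ∈ Finset.Icc 1 j
    · simp only [ext, dif_pos hk]
      exact measurable_pi_apply _
    · simp only [ext, dif_neg hk]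
      exact measurable_const
  have hm : Measurable fun v : S' → Vec T => φ (iter U C α (fun k => ext k v) r₁ j) :=
    hφ.comp (measurable_pi_lambda _ fun i => measurable_iter hc hcl hne hg (fun k _ => hext k) i)
  have h' := h.comp (measurable_pi_apply (⟨⟨j + 1, by simp; omega⟩, by simp [S]⟩ : S)) hm
  have e (ω : Ω) : iter U C α (fun k => w k ω) r₁ j =
      iter U C α (fun k => ext k fun i => w i.1.1 ω) r₁ j := by
    refine iter_congr fun k hk => ?_
    simp only [ext, dif_pos hk]
  simp only [e]
  exact h'

/-- The second moment of a shifted random variable (Minkowski's inequality). -/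
lemma integral_add_sq_le {Ω : Type*} [MeasurableSpace Ω] {μ : Measure Ω} [IsProbabilityMeasure μ]
    {X : Ω → ℝ} (h1 : Integrable X μ) (h2 : Integrable (fun ω => X ω ^ 2) μ) {a s : ℝ}
    (ha : 0 ≤ a) (hs : 0 ≤ s) (h : ∫ ω, X ω ^ 2 ∂μ ≤ s ^ 2) :
    Integrable (fun ω => (a + X ω) ^ 2) μ ∧ ∫ ω, (a + X ω) ^ 2 ∂μ ≤ (a + s) ^ 2 := by
  have expand (t : ℝ) : (fun ω => (t + X ω) ^ 2) = fun ω => t ^ 2 + 2 * t * X ω + X ω ^ 2 := by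
    funext ω
    ring
  have hint (t : ℝ) : Integrable (fun ω => t ^ 2 + 2 * t * X ω) μ :=
    (integrable_const _).add (h1.const_mul _)
  have hval (t : ℝ) : ∫ ω, (t + X ω) ^ 2 ∂μ = t ^ 2 + 2 * t * ∫ ω, X ω ∂μ + ∫ ω, X ω ^ 2 ∂μ := by
    rw [expand, integral_add (hint t) h2, integral_add (integrable_const _) (h1.const_mul _),
      integral_const_mul]
    simp
  refine ⟨by rw [expand]; exact (hint a).add h2, ?_⟩
  -- Nonnegativity of the variance bounds the mean by `s`, which controls the cross term.
  have h0 : 0 ≤ ∫ ω, (-(∫ ω, X ω ∂μ) + X ω) ^ 2 ∂μ := integral_nonneg fun ω => sq_nonneg _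
  rw [hval] at h0
  have hm : ∫ ω, X ω ∂μ ≤ s := (abs_le_of_sq_le_sq' (by linarith) hs).2
  rw [hval]
  nlinarith [mul_le_mul_of_nonneg_left hm ha]

end DPGD

/-! ### Descent in expectation and the rate against a fixed feasible point. -/

namespace DPGD

variable {n T K : ℕ} {U : Vec T → ℝ} {C : Fin n → Set (Vec T)} {α : ℕ → ℝ} {r₁ : Fin n → Vec T}
  {ρ G L Δ ε η : ℝ} {Ω : Type*} [MeasurableSpace Ω] {μ : Measure Ω} {w : ℕ → Ω → Vec T}

lemma continuous_gradient_of_lipschitz {E : Type*} [NormedAddCommGroup E] [InnerProductSpace ℝ E]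
    [CompleteSpace E] {U : E → ℝ} {L : ℝ} (hL : 0 ≤ L)
    (h : ∀ x y, ‖gradient U x - gradient U y‖ ≤ L * ‖x - y‖) : Continuous (gradient U) :=
  (LipschitzWith.of_dist_le_mul (K := ⟨L, hL⟩) fun x y => by
    rw [dist_eq_norm, dist_eq_norm]
    exact h x y).continuous

/-- The moments of the noise vectors. -/
lemma IsNoise.moments (hw : IsNoise μ T K L Δ ε w) (hL : 0 < L) (hΔ : 0 < Δ) (hε : 0 < ε) {k : ℕ}
    (hk : k ∈ Finset.Icc 2 K) :
    Integrable (w k) μ ∧ ∫ ω, w k ω ∂μ = 0 ∧ Integrable (fun ω => ‖w k ω‖ ^ 2) μ ∧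
      ∫ ω, ‖w k ω‖ ^ 2 ∂μ ≤ (√2 * T * (K : ℝ) ^ 2 * L * Δ / (2 * ε)) ^ 2 := by
  have hk' := Finset.mem_Icc.1 hk
  have hm : AEMeasurable (w k) μ := (hw.measurable k (by simp; omega)).aemeasurable
  have hK : (2 : ℝ) ≤ K := by exact_mod_cast hk'.1.trans hk'.2
  have hK1 : 0 < (K : ℝ) - 1 := by linarith
  have hK0 : 0 < (K : ℝ) := by linarith
  set b := 2 * ε / ((K : ℝ) * ((K : ℝ) - 1) * L * Δ) with hb_def
  have hb : 0 < b := by positivity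
  have hbe (x : ℝ) : 2 * ε * x / ((K : ℝ) * ((K : ℝ) - 1) * L * Δ) = b * x := by
    rw [hb_def]; ring
  have hlaw := hw.law k hk
  have i2 := integrable_norm_pow_noiseLaw (T := T) hb hbe 2
  have i1 := integrable_norm_pow_noiseLaw (T := T) hb hbe 1
  have v2 := integral_noiseLaw_norm_sq (T := T) hb hbe
  have v1 := integral_noiseLaw_id (T := T) hb hbe
  simp only [pow_one] at i1
  replace i1 : Integrable (fun x : Vec T => x) (noiseLaw T K L Δ ε) :=
    (integrable_norm_iff aestronglyMeasurable_id).1 i1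
  rw [← hlaw] at i1 i2 v1 v2
  refine ⟨i1.comp_aemeasurable hm, ?_, i2.comp_aemeasurable hm, ?_⟩
  · rwa [integral_map hm (f := fun x : Vec T => x) aestronglyMeasurable_id] at v1
  · rw [integral_map hm (by fun_prop)] at v2
    rw [v2]
    -- Source of the factor `√2 T`; the factor `K²` comes from `K (K - 1) ≤ K²` below.
    have hT : (T : ℝ) * (T + 1) ≤ 2 * T ^ 2 := by
      rcases Nat.eq_zero_or_pos T with h | h
      · simp [h]
      · have : (1 : ℝ) ≤ T := by exact_mod_cast h
        nlinarith
    have hbi : 1 / b ≤ (K : ℝ) ^ 2 * L * Δ / (2 * ε) := by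
      rw [hb_def, one_div_div]
      have : (K : ℝ) * (K - 1) ≤ K ^ 2 := by nlinarith
      gcongr
    calc (T : ℝ) * (T + 1) / b ^ 2 = (T * (T + 1)) * (1 / b) ^ 2 := by ring
      _ ≤ (2 * T ^ 2) * ((K : ℝ) ^ 2 * L * Δ / (2 * ε)) ^ 2 := by gcongr
      _ = (√2) ^ 2 * T ^ 2 * ((K : ℝ) ^ 2 * L * Δ / (2 * ε)) ^ 2 := by
        rw [Real.sq_sqrt zero_le_two]
      _ = _ := by ring

/-- `U` is bounded along feasible points, so no moment of the noise is required. -/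
lemma integrable_objective_of_mem_feasible [IsFiniteMeasure μ] (hd : Differentiable ℝ U)
    (hU : ConvexOn ℝ Set.univ U) (hρ : IsGreatest (feasNorms C) ρ)
    (hG : IsGreatest (feasGradNorms U C) G) {X : Ω → Fin n → Vec T}
    (hX : ∀ i, Measurable fun ω => X ω i) (hmem : ∀ ω, X ω ∈ feasible C) :
    Integrable (fun ω => U (∑ i, X ω i)) μ := by
  obtain ⟨z, hz, -⟩ := hρ.1
  have hm : Measurable fun ω => U (∑ i, X ω i) :=
    hd.continuous.measurable.comp (Finset.measurable_sum _ fun i _ => hX i)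
  refine Integrable.of_bound hm.aestronglyMeasurable (|U (∑ i, z i)| + 2 * √n * ρ * G)
    (Filter.Eventually.of_forall fun ω => ?_)
  have h := abs_sub_le_of_mem_feasible hd hU hρ hG (hmem ω) hz
  have h' := abs_sub_abs_le_abs_sub (U (∑ i, X ω i)) (U (∑ i, z i))
  rw [Real.norm_eq_abs]
  linarith

lemma integrable_sq_dist_of_mem_feasible [IsFiniteMeasure μ] (hρ : IsGreatest (feasNorms C) ρ)
    {X : Ω → Fin n → Vec T} (hX : ∀ i, Measurable fun ω => X ω i) (hmem : ∀ ω, X ω ∈ feasible C)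
    {z : Fin n → Vec T} (hz : z ∈ feasible C) :
    Integrable (fun ω => ∑ i, ‖X ω i - z i‖ ^ 2) μ := by
  have hm : Measurable fun ω => ∑ i, ‖X ω i - z i‖ ^ 2 :=
    Finset.measurable_sum _ fun i _ => (((hX i).sub_const _).norm).pow_const 2
  refine Integrable.of_bound hm.aestronglyMeasurable (4 * ρ ^ 2)
    (Filter.Eventually.of_forall fun ω => ?_)
  rw [Real.norm_of_nonneg (by positivity)]
  exact sum_norm_sub_sq_le hρ (hmem ω) hz

/-- The one-step descent inequality in expectation. -/
lemma expected_descent_step [IsProbabilityMeasure μ] (hd : Differentiable ℝ U)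
    (hU : ConvexOn ℝ Set.univ U) (hg : Continuous (gradient U))
    (hc : ∀ i, Convex ℝ (C i)) (hcl : ∀ i, IsClosed (C i)) (hne : ∀ i, (C i).Nonempty)
    (hρ : IsGreatest (feasNorms C) ρ) (hG : IsGreatest (feasGradNorms U C) G)
    (hw : IsNoise μ T K L Δ ε w) (hL : 0 < L) (hΔ : 0 < Δ) (hε : 0 < ε)
    {z : Fin n → Vec T} (hz : z ∈ feasible C) {j : ℕ} (hj : j + 2 ≤ K) (ha : 0 ≤ α (j + 2)) :
    2 * α (j + 2) *
        (∫ ω, U (∑ i, iter U C α (fun k => w k ω) r₁ (j + 1) i) ∂μ - U (∑ i, z i)) ≤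
      ∫ ω, ∑ i, ‖iter U C α (fun k => w k ω) r₁ (j + 1) i - z i‖ ^ 2 ∂μ -
        ∫ ω, ∑ i, ‖iter U C α (fun k => w k ω) r₁ (j + 2) i - z i‖ ^ 2 ∂μ +
        α (j + 2) ^ 2 * gradConst n T K G L Δ ε ^ 2 := by
  obtain ⟨w1, w0, w2, wv⟩ := hw.moments hL hΔ hε (k := j + 2) (by simp; omega)
  have hG0 := nonneg_of_isGreatest_feasGradNorms hG
  obtain ⟨q1, q2⟩ := integral_add_sq_le w1.norm w2 hG0 (by positivity) wv
  have hmeas (m : ℕ) (hm : m ≤ K) (i : Fin n) :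
      Measurable fun ω => iter U C α (fun k => w k ω) r₁ m i :=
    measurable_iter hc hcl hne hg (fun k hk => hw.measurable k (by simp at hk ⊢; omega)) i
  have hfeas (m : ℕ) (ω : Ω) : iter U C α (fun k => w k ω) r₁ (m + 1) ∈ feasible C :=
    iter_succ_mem_feasible hc hcl hne _ m
  have iU := integrable_objective_of_mem_feasible (μ := μ) hd hU hρ hG
    (hmeas (j + 1) (by omega)) (hfeas j)
  have iD := integrable_sq_dist_of_mem_feasible (μ := μ) hρ (hmeas (j + 1) (by omega)) (hfeas j) hz
  have iD' := integrable_sq_dist_of_mem_feasible (μ := μ) hρ (hmeas (j + 2) hj) (hfeas (j + 1)) hz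
  have mY : Measurable fun ω => ∑ i, (iter U C α (fun k => w k ω) r₁ (j + 1) i - z i) :=
    Finset.measurable_sum _ fun i _ => (hmeas (j + 1) (by omega) i).sub_const _
  have iY : Integrable (fun ω => ∑ i, (iter U C α (fun k => w k ω) r₁ (j + 1) i - z i)) μ :=
    Integrable.of_bound mY.aestronglyMeasurable (2 * √n * ρ)
      (Filter.Eventually.of_forall fun ω => norm_sum_sub_le hρ (hfeas j ω) hz)
  have iI : Integrable (fun ω => (inner ℝ (w (j + 2) ω)
      (∑ i, (iter U C α (fun k => w k ω) r₁ (j + 1) i - z i)) : ℝ)) μ := by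
    refine (w1.norm.mul_const (2 * √n * ρ)).mono'
      (w1.aestronglyMeasurable.inner iY.aestronglyMeasurable)
      (Filter.Eventually.of_forall fun ω => (norm_inner_le_norm _ _).trans ?_)
    exact mul_le_mul_of_nonneg_left (norm_sum_sub_le hρ (hfeas j ω) hz) (norm_nonneg _)
  -- The iterate at index `j + 1` depends only on `w_1, …, w_{j+1}`, so the expectation of the inner
  -- product factors and the zero mean of `w_{j+2}` kills it.
  have vI : ∫ ω, (inner ℝ (w (j + 2) ω)
      (∑ i, (iter U C α (fun k => w k ω) r₁ (j + 1) i - z i)) : ℝ) ∂μ = 0 := by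
    have hind := indepFun_iter (α := α) (r₁ := r₁) hc hcl hne hg hw.measurable hw.indep
      (show j + 1 < K by omega) (φ := fun x => ∑ i, (x i - z i)) (by fun_prop)
    have := hind.integral_bilin w1 iY (innerSL ℝ)
    rwa [w0, map_zero, zero_apply] at this
  have key : ∫ ω, 2 * α (j + 2) *
        (U (∑ i, iter U C α (fun k => w k ω) r₁ (j + 1) i) - U (∑ i, z i)) ∂μ ≤
      ∫ ω, (∑ i, ‖iter U C α (fun k => w k ω) r₁ (j + 1) i - z i‖ ^ 2 -
        ∑ i, ‖iter U C α (fun k => w k ω) r₁ (j + 2) i - z i‖ ^ 2 +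
        α (j + 2) ^ 2 * (n * (G + ‖w (j + 2) ω‖) ^ 2) -
        2 * α (j + 2) * inner ℝ (w (j + 2) ω)
          (∑ i, (iter U C α (fun k => w k ω) r₁ (j + 1) i - z i))) ∂μ :=
    integral_mono ((iU.sub (integrable_const _)).const_mul _)
      (((iD.sub iD').add ((q1.const_mul _).const_mul _)).sub (iI.const_mul _))
      fun ω => descent_step hd hU hc hcl hG (hfeas j ω) hz ha (w (j + 2) ω)
  have split {f₁ f₂ f₃ f₄ : Ω → ℝ} (i₁ : Integrable f₁ μ) (i₂ : Integrable f₂ μ)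
      (i₃ : Integrable f₃ μ) (i₄ : Integrable f₄ μ) :
      ∫ ω, (f₁ ω - f₂ ω + f₃ ω - f₄ ω) ∂μ =
        ∫ ω, f₁ ω ∂μ - ∫ ω, f₂ ω ∂μ + ∫ ω, f₃ ω ∂μ - ∫ ω, f₄ ω ∂μ := by
    rw [integral_sub (by fun_prop) i₄, integral_add (by fun_prop) i₃, integral_sub i₁ i₂]
  rw [integral_const_mul, integral_sub iU (integrable_const _),
    split iD iD' ((q1.const_mul _).const_mul _) (iI.const_mul _),
    integral_const_mul, integral_const_mul, integral_const_mul, vI] at key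
  simp only [integral_const, probReal_univ, one_smul, mul_zero, sub_zero] at key
  refine key.trans ?_
  rw [gradConst, mul_pow, Real.sq_sqrt (Nat.cast_nonneg n)]
  gcongr

lemma two_mul_le_sq_div_add {x y c : ℝ} (hc : 0 < c) : 2 * x * y ≤ x ^ 2 / c + c * y ^ 2 := by
  have h : x ^ 2 / c + c * y ^ 2 - 2 * x * y = (x - c * y) ^ 2 / c := by
    field_simp
    ring
  have : 0 ≤ (x - c * y) ^ 2 / c := by positivity
  linarith

/-- The error after the last step, whose iterate is only bounded by the diameter. -/
lemma last_step_bound {c V e e' h d : ℝ} (hη : 1 ≤ η) (hc : 0 < c) (hV : 0 ≤ V) (m : ℕ) (hd : 0 ≤ d)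
    (h1 : e + avgWeight η (m + 1) * √((m : ℝ) + 2) * d / (2 * c) ≤
      avgWeight η (m + 1) * √((m : ℝ) + 2) * (4 * ρ ^ 2) / (2 * c) + c * V / √((m : ℝ) + 1))
    (h2 : e' ≤ (1 - avgWeight η (m + 2)) * e + avgWeight η (m + 2) * h)
    (h3 : h ≤ ρ ^ 2 / c + c * V) :
    e' ≤ 6 * (η * (ρ ^ 2 / c + c * V) / √((m : ℝ) + 2)) := by
  have hm0 : (0 : ℝ) ≤ m := Nat.cast_nonneg m
  have hw1 : avgWeight η (m + 1) = (η + 1) / (η + (m + 1)) := by simp [avgWeight]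
  have hw2 : avgWeight η (m + 2) = (η + 1) / (η + (m + 2)) := by simp [avgWeight]
  set θ := avgWeight η (m + 1)
  set θ' := avgWeight η (m + 2)
  set S := √((m : ℝ) + 2) with hS
  have hS0 : 0 < S := by positivity
  have hSS : S * S = m + 2 := Real.mul_self_sqrt (by positivity)
  have hS1 : 1 ≤ S := Real.one_le_sqrt.2 (by linarith)
  have hθ : 0 ≤ θ := avgWeight_nonneg hη _
  have hθ' : 0 ≤ θ' := avgWeight_nonneg hη _
  have hθ1 : 1 - θ' = (m + 1) / (η + (m + 2)) := by rw [hw2]; field_simp; ring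
  have hθ1' : 0 ≤ 1 - θ' := by rw [hθ1]; positivity
  have hmono : (1 - θ') * θ ≤ θ' := by
    rw [hθ1, hw1, hw2, div_mul_div_comm, div_le_div_iff₀ (by positivity) (by positivity)]
    have : 0 ≤ (η + 1) * (η + (m + 2)) := by positivity
    nlinarith
  -- As `S² = m + 2`, this says `θ' ≤ 2 η / (m + 2)`.
  have hθS : θ' * S ≤ 2 * η / S := by
    rw [le_div_iff₀ hS0, mul_assoc, hSS, hw2, div_mul_eq_mul_div, div_le_iff₀ (by positivity)]
    nlinarith [mul_nonneg (sub_nonneg.2 hη) hm0]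
  have hθ2 : θ' ≤ 2 * η / S := (le_mul_of_one_le_right hθ' hS1).trans hθS
  have hlast : (1 - θ') * (1 / √((m : ℝ) + 1)) ≤ 1 / S := by
    have s1 : 0 < √((m : ℝ) + 1) := by positivity
    have s2 : √((m : ℝ) + 1) * √((m : ℝ) + 1) = m + 1 := Real.mul_self_sqrt (by positivity)
    have s3 : √((m : ℝ) + 1) ≤ S := Real.sqrt_le_sqrt (by linarith)
    rw [hθ1, div_mul_div_comm, div_le_div_iff₀ (by positivity) hS0]
    have s4 := mul_le_mul_of_nonneg_left s3 hS0.le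
    have s5 : (m + 1) * S ≤ (η + (m + 2)) * √((m : ℝ) + 1) := by
      calc _ = √((m : ℝ) + 1) * (S * √((m : ℝ) + 1)) := by linear_combination (-S) * s2
        _ ≤ √((m : ℝ) + 1) * (η + (m + 2)) := mul_le_mul_of_nonneg_left (by linarith) s1.le
        _ = _ := mul_comm _ _
    linarith
  have h4 : e ≤ θ * S * (4 * ρ ^ 2) / (2 * c) + c * V / √((m : ℝ) + 1) := by
    have : 0 ≤ θ * S * d / (2 * c) := by positivity
    linarith
  set M := ρ ^ 2 / c + c * V with hM
  have hρc : 0 ≤ ρ ^ 2 / c := by positivity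
  have hcV : 0 ≤ c * V := by positivity
  have hM0 : 0 ≤ M := add_nonneg hρc hcV
  have a1 : (1 - θ') * (θ * S * (4 * ρ ^ 2) / (2 * c)) ≤ 4 * (η / S * (ρ ^ 2 / c)) := by
    calc _ = ((1 - θ') * θ) * (S * (2 * (ρ ^ 2 / c))) := by ring
      _ ≤ θ' * (S * (2 * (ρ ^ 2 / c))) := mul_le_mul_of_nonneg_right hmono (by positivity)
      _ = (θ' * S) * (2 * (ρ ^ 2 / c)) := by ring
      _ ≤ (2 * η / S) * (2 * (ρ ^ 2 / c)) := mul_le_mul_of_nonneg_right hθS (by positivity)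
      _ = _ := by ring
  have a2 : (1 - θ') * (c * V / √((m : ℝ) + 1)) ≤ η / S * (c * V) := by
    calc _ = ((1 - θ') * (1 / √((m : ℝ) + 1))) * (c * V) := by ring
      _ ≤ (1 / S) * (c * V) := mul_le_mul_of_nonneg_right hlast hcV
      _ ≤ (η / S) * (c * V) := mul_le_mul_of_nonneg_right (div_le_div_of_nonneg_right hη hS0.le) hcV
  have a3 : θ' * h ≤ 2 * (η / S * M) := by
    calc _ ≤ θ' * M := mul_le_mul_of_nonneg_left h3 hθ'
      _ ≤ (2 * η / S) * M := mul_le_mul_of_nonneg_right hθ2 hM0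
      _ = _ := by ring
  have a4 := mul_le_mul_of_nonneg_left h4 hθ1'
  have a5 : 0 ≤ η / S * (c * V) := by positivity
  have a6 : η * M / S = η / S * (ρ ^ 2 / c) + η / S * (c * V) := by rw [hM]; ring
  have a7 : η / S * M = η / S * (ρ ^ 2 / c) + η / S * (c * V) := by rw [hM]; ring
  -- The distance part contributes 4 and the last iterate 2 to the coefficient of `ρ² / c`, hence
  -- the 6; for `c V` the total is only 3.
  linarith

/-- The convergence rate relative to an arbitrary feasible point. -/
lemma expected_objective_le [IsProbabilityMeasure μ] (hd : Differentiable ℝ U)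
    (hU : ConvexOn ℝ Set.univ U) (hg : Continuous (gradient U))
    (hc : ∀ i, Convex ℝ (C i)) (hcl : ∀ i, IsClosed (C i)) (hne : ∀ i, (C i).Nonempty)
    (hρ : IsGreatest (feasNorms C) ρ) (hG : IsGreatest (feasGradNorms U C) G)
    (hw : IsNoise μ T K L Δ ε w) (hL : 0 < L) (hΔ : 0 < Δ) (hε : 0 < ε) (hη : 1 ≤ η) (hK : 1 ≤ K)
    {c : ℝ} (hc0 : 0 < c) {z : Fin n → Vec T} (hz : z ∈ feasible C) :
    ∫ ω, U (∑ i, avgIter U C (fun k => c / √k) η (fun k => w k ω) r₁ K i) ∂μ - U (∑ i, z i) ≤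
      6 * (η * (ρ ^ 2 / c + c * gradConst n T K G L Δ ε ^ 2) / √K) := by
  set V := gradConst n T K G L Δ ε ^ 2 with hV
  have hV0 : 0 ≤ V := sq_nonneg _
  have hρ0 := nonneg_of_isGreatest_feasNorms hρ
  have hG0 := nonneg_of_isGreatest_feasGradNorms hG
  set M := ρ ^ 2 / c + c * V with hM
  have hM0 : 0 ≤ M := by positivity
  -- The oscillation of `U` is put in the form of the target rate by AM–GM, using `√n G ≤ Ĝ`.
  have hB : 2 * √n * ρ * G ≤ M := by
    have h1 := two_mul_le_sq_div_add (x := ρ) (y := √n * G) hc0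
    have h2 : (√n * G) ^ 2 ≤ V := by
      refine pow_le_pow_left₀ (by positivity) ?_ 2
      refine mul_le_mul_of_nonneg_left (le_add_of_nonneg_right ?_) (Real.sqrt_nonneg _)
      positivity
    have h3 := mul_le_mul_of_nonneg_left h2 hc0.le
    linarith
  set α : ℕ → ℝ := fun k => c / √k with hα
  have hmeas (m : ℕ) (hm : m ≤ K) (i : Fin n) :
      Measurable fun ω => iter U C α (fun k => w k ω) r₁ m i :=
    measurable_iter hc hcl hne hg (fun k hk => hw.measurable k (by simp at hk ⊢; omega)) i
  have hmeas' (m : ℕ) (hm : m ≤ K) (i : Fin n) :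
      Measurable fun ω => avgIter U C α η (fun k => w k ω) r₁ m i :=
    measurable_avgIter hc hcl hne hg (fun k hk => hw.measurable k (by simp at hk ⊢; omega)) i
  have iI (m : ℕ) (hm : m + 1 ≤ K) :
      Integrable (fun ω => U (∑ i, iter U C α (fun k => w k ω) r₁ (m + 1) i)) μ :=
    integrable_objective_of_mem_feasible hd hU hρ hG (hmeas (m + 1) hm)
      fun ω => iter_succ_mem_feasible hc hcl hne _ m
  have iA (m : ℕ) (hm : m ≤ K) :
      Integrable (fun ω => U (∑ i, avgIter U C α η (fun k => w k ω) r₁ m i)) μ := by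
    cases m with
    -- The starting point may be infeasible, but it is deterministic.
    | zero => exact integrable_const (U (∑ i, r₁ i))
    | succ m =>
      exact integrable_objective_of_mem_feasible hd hU hρ hG (hmeas' (m + 1) hm)
        fun ω => avgIter_succ_mem_feasible hc hcl hne hη _ m
  -- Index `m` refers to `r^(m+1)` and its average, so the descent step for `h (m + 1)` uses step
  -- size `α (m + 2)` while averaging uses `θ_{m+1}`.
  let e : ℕ → ℝ := fun m =>
    ∫ ω, U (∑ i, avgIter U C α η (fun k => w k ω) r₁ m i) ∂μ - U (∑ i, z i)
  let h : ℕ → ℝ := fun m => ∫ ω, U (∑ i, iter U C α (fun k => w k ω) r₁ m i) ∂μ - U (∑ i, z i)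
  let d : ℕ → ℝ := fun m => ∫ ω, ∑ i, ‖iter U C α (fun k => w k ω) r₁ m i - z i‖ ^ 2 ∂μ
  have he (m : ℕ) (hm : m + 1 ≤ K) :
      e (m + 1) ≤ (1 - avgWeight η (m + 1)) * e m + avgWeight η (m + 1) * h (m + 1) := by
    have := integral_mono (iA (m + 1) hm)
      (((iA m (by omega)).const_mul (1 - avgWeight η (m + 1))).add
        ((iI m hm).const_mul (avgWeight η (m + 1))))
      fun ω => objective_avgIter_succ_le hU hη (fun k => w k ω) m
    simp only [Pi.add_apply] at this
    rw [integral_add ((iA m (by omega)).const_mul _) ((iI m hm).const_mul _), integral_const_mul,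
      integral_const_mul] at this
    simp only [e, h]
    linarith
  have hhB (m : ℕ) (hm : m + 1 ≤ K) : h (m + 1) ≤ M := by
    have hp (ω : Ω) : U (∑ i, iter U C α (fun k => w k ω) r₁ (m + 1) i) ≤ M + U (∑ i, z i) := by
      have := sub_le_of_mem_feasible hd hU hρ hG
        (iter_succ_mem_feasible (U := U) (r₁ := r₁) (α := α) hc hcl hne (fun k => w k ω) m) hz
      linarith
    have := integral_mono (iI m hm) (integrable_const (M + U (∑ i, z i))) hp
    simp only [integral_const, probReal_univ, one_smul] at this
    simp only [h]
    linarith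
  have hd0 (m : ℕ) : 0 ≤ d m := integral_nonneg fun ω => by positivity
  have hdR (m : ℕ) : d (m + 1) ≤ 4 * ρ ^ 2 := by
    refine (integral_mono_of_nonneg (Filter.Eventually.of_forall fun ω => by positivity)
      (integrable_const (4 * ρ ^ 2)) (Filter.Eventually.of_forall fun ω => ?_)).trans_eq (by simp)
    exact sum_norm_sub_sq_le hρ (iter_succ_mem_feasible hc hcl hne _ m) hz
  have hh (m : ℕ) (hm : m + 1 < K) : h (m + 1) ≤
      √((m : ℝ) + 2) * (d (m + 1) - d (m + 2)) / (2 * c) + c * V / (2 * √((m : ℝ) + 2)) := by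
    have h1 := expected_descent_step (α := α) (r₁ := r₁) hd hU hg hc hcl hne hρ hG hw hL hΔ hε hz
      (j := m) (by omega) (by simp only [hα]; positivity)
    have ha : α (m + 2) = c / √((m : ℝ) + 2) := by simp [hα]
    have hs : 0 < √((m : ℝ) + 2) := by positivity
    rw [ha, ← hV] at h1
    change 2 * (c / √((m : ℝ) + 2)) * h (m + 1) ≤
      d (m + 1) - d (m + 2) + (c / √((m : ℝ) + 2)) ^ 2 * V at h1
    have h2 := mul_le_mul_of_nonneg_left h1 (show 0 ≤ √((m : ℝ) + 2) / (2 * c) by positivity)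
    have e1 : √((m : ℝ) + 2) / (2 * c) * (2 * (c / √((m : ℝ) + 2)) * h (m + 1)) = h (m + 1) := by
      field_simp
    have e2 : √((m : ℝ) + 2) / (2 * c) *
        (d (m + 1) - d (m + 2) + (c / √((m : ℝ) + 2)) ^ 2 * V) =
        √((m : ℝ) + 2) * (d (m + 1) - d (m + 2)) / (2 * c) + c * V / (2 * √((m : ℝ) + 2)) := by
      field_simp
    rwa [e1, e2] at h2
  change e K ≤ _
  -- For `K = 1` no descent step is available; the output is the projected point `r^(2)`, and the
  -- oscillation bound suffices.
  obtain rfl | hK2 := hK.eq_or_lt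
  · have h1 := he 0 le_rfl
    have h2 := hhB 0 le_rfl
    simp only [zero_add, avgWeight_one hη, sub_self, zero_mul, one_mul] at h1 h2
    simp only [Nat.cast_one, Real.sqrt_one, div_one]
    nlinarith
  obtain ⟨m, rfl⟩ : ∃ m, K = m + 2 := ⟨K - 2, by omega⟩
  have h1 := error_recursion hη hc0 hV0 (fun k hk => he k hk.le) hh hdR m (by omega)
  have h2 := he (m + 1) le_rfl
  have h3 := hhB (m + 1) le_rfl
  rw [show ((m + 2 : ℕ) : ℝ) = m + 2 by push_cast; ring]
  exact last_step_bound hη hc0 hV0 m (hd0 _) h1 h2 h3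

end DPGD

/-! ### Passage to the infimum and the choice of step size. -/

namespace DPGD

variable {n T K : ℕ} {U : Vec T → ℝ} {C : Fin n → Set (Vec T)} {r₁ : Fin n → Vec T}
  {ρ G L Δ ε η c : ℝ} {Ω : Type*} [MeasurableSpace Ω] {μ : Measure Ω} {w : ℕ → Ω → Vec T}

lemma integrable_objective_avgIter [IsFiniteMeasure μ] (hd : Differentiable ℝ U)
    (hU : ConvexOn ℝ Set.univ U) (hg : Continuous (gradient U))
    (hc : ∀ i, Convex ℝ (C i)) (hcl : ∀ i, IsClosed (C i)) (hne : ∀ i, (C i).Nonempty)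
    (hρ : IsGreatest (feasNorms C) ρ) (hG : IsGreatest (feasGradNorms U C) G)
    (hw : IsNoise μ T K L Δ ε w) (hη : 1 ≤ η) (hK : 1 ≤ K) (α : ℕ → ℝ) :
    Integrable (fun ω => U (∑ i, avgIter U C α η (fun k => w k ω) r₁ K i)) μ := by
  obtain ⟨m, rfl⟩ : ∃ m, K = m + 1 := ⟨K - 1, by omega⟩
  exact integrable_objective_of_mem_feasible hd hU hρ hG
    (fun i => measurable_avgIter hc hcl hne hg hw.measurable i)
    fun ω => avgIter_succ_mem_feasible hc hcl hne hη _ m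

/-- A bound uniform over feasible `z` makes the expected objective minus `B` a lower bound of all
feasible values, so no minimizer is needed. -/
lemma integral_subopt_le [IsProbabilityMeasure μ] (hne : ∀ i, (C i).Nonempty)
    (hi : Integrable
      (fun ω => U (∑ i, avgIter U C (fun k => c / √k) η (fun k => w k ω) r₁ K i)) μ) {B : ℝ}
    (h : ∀ z ∈ feasible C,
      ∫ ω, U (∑ i, avgIter U C (fun k => c / √k) η (fun k => w k ω) r₁ K i) ∂μ - U (∑ i, z i) ≤ B) :
    ∫ ω, subopt U C K c η (fun k => w k ω) r₁ ∂μ ≤ B := by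
  have hopt : ∫ ω, U (∑ i, avgIter U C (fun k => c / √k) η (fun k => w k ω) r₁ K i) ∂μ - B ≤
      optVal U C := by
    refine le_csInf ?_ ?_
    · choose z hz using hne
      exact ⟨_, z, hz, rfl⟩
    · rintro _ ⟨z, hz, rfl⟩
      have := h z hz
      dsimp only
      linarith
  simp only [subopt]
  rw [integral_sub hi (integrable_const _)]
  simp only [integral_const, probReal_univ, one_smul]
  linarith

end DPGD

theorem theorem2 :
    ∃ A : ℝ, 0 < A ∧
      ∀ (n T K : ℕ) (_hK : 1 ≤ K)
        (U : DPGD.Vec T → ℝ) (_hUdiff : Differentiable ℝ U) (_hUconv : ConvexOn ℝ Set.univ U)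
        (L : ℝ) (_hL : 0 < L)
        (_hULip : ∀ x y, ‖gradient U x - gradient U y‖ ≤ L * ‖x - y‖)
        (C : Fin n → Set (DPGD.Vec T)) (_hCconv : ∀ i, Convex ℝ (C i))
        (_hCclosed : ∀ i, IsClosed (C i)) (_hCne : ∀ i, (C i).Nonempty)
        (ρ G : ℝ) (_hρ : IsGreatest (DPGD.feasNorms C) ρ)
        (_hG : IsGreatest (DPGD.feasGradNorms U C) G)
        (η : ℝ) (_hη : 1 ≤ η) (Δ : ℝ) (_hΔ : 0 < Δ) (ε : ℝ) (_hε : 0 < ε)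
        (Ω : Type*) [MeasurableSpace Ω] (μ : Measure Ω) [IsProbabilityMeasure μ]
        (w : ℕ → Ω → DPGD.Vec T) (_hw : DPGD.IsNoise μ T K L Δ ε w)
        (r₁ : Fin n → DPGD.Vec T),
        (∀ c : ℝ, 0 < c →
          Integrable (fun ω => DPGD.subopt U C K c η (fun k => w k ω) r₁) μ ∧
          ∫ ω, DPGD.subopt U C K c η (fun k => w k ω) r₁ ∂μ ≤
            A * (η * (ρ ^ 2 / c + c * DPGD.gradConst n T K G L Δ ε ^ 2) / Real.sqrt K)) ∧
        (∀ c : ℝ, c = ρ / DPGD.gradConst n T K G L Δ ε →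
          Integrable (fun ω => DPGD.subopt U C K c η (fun k => w k ω) r₁) μ ∧
          ∫ ω, DPGD.subopt U C K c η (fun k => w k ω) r₁ ∂μ ≤
            A * (η * Real.sqrt n * ρ *
              (G / Real.sqrt K +
                Real.sqrt 2 * T * (K : ℝ) ^ (3 / 2 : ℝ) * L * Δ / (2 * ε)))) := by
  -- The rate has constant 6; at `c = ρ / Ĝ` the two terms of `ρ² / c + c Ĝ²` both equal `ρ Ĝ`,
  -- which doubles it.
  refine ⟨12, by norm_num, ?_⟩
  intro n T K hK U hd hU L hL hLip C hc hcl hne ρ G hρ hG η hη Δ hΔ ε hε Ω _ μ _ w hw r₁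
  have hg := DPGD.continuous_gradient_of_lipschitz hL.le hLip
  have hρ0 := DPGD.nonneg_of_isGreatest_feasNorms hρ
  have hG0 := DPGD.nonneg_of_isGreatest_feasGradNorms hG
  have hK0 : (0 : ℝ) < K := by exact_mod_cast hK
  have hint (c : ℝ) := DPGD.integrable_objective_avgIter (r₁ := r₁) hd hU hg hc hcl hne hρ hG hw
    hη hK (fun k => c / √k)
  have hsub (c : ℝ) : Integrable (fun ω => DPGD.subopt U C K c η (fun k => w k ω) r₁) μ :=
    (hint c).sub (integrable_const _)
  have hmain (c : ℝ) (hc0 : 0 < c) := DPGD.integral_subopt_le hne (hint c) fun z hz =>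
    DPGD.expected_objective_le hd hU hg hc hcl hne hρ hG hw hL hΔ hε hη hK hc0 hz
  refine ⟨fun c hc0 => ⟨hsub c, (hmain c hc0).trans ?_⟩, fun c hcdef => ⟨hsub c, ?_⟩⟩
  · exact mul_le_mul_of_nonneg_right (by norm_num) (by positivity)
  have hs : 0 ≤ √2 * T * (K : ℝ) ^ 2 * L * Δ / (2 * ε) := by positivity
  have hĜ : √n * G ≤ DPGD.gradConst n T K G L Δ ε :=
    mul_le_mul_of_nonneg_left (le_add_of_nonneg_right hs) (Real.sqrt_nonneg _)
  have hĜ0 : 0 ≤ DPGD.gradConst n T K G L Δ ε := le_trans (by positivity) hĜ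
  have hpow : (K : ℝ) ^ (3 / 2 : ℝ) = (K : ℝ) ^ 2 / √K := by
    rw [Real.sqrt_eq_rpow, ← Real.rpow_natCast, ← Real.rpow_sub hK0]
    norm_num
  have hrhs : η * √n * ρ * (G / √K + √2 * T * (K : ℝ) ^ (3 / 2 : ℝ) * L * Δ / (2 * ε)) =
      η * (ρ * DPGD.gradConst n T K G L Δ ε) / √K := by
    rw [hpow, DPGD.gradConst]
    ring
  rw [hrhs]
  -- If `ρ Ĝ = 0` then `c = 0` (division by zero included) and the rate for `c > 0` does not apply.
  -- But then `√n ρ G = 0`, so `U` is constant over the feasible set and the suboptimality is at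
  -- most 0.
  obtain h0 | h0 := (mul_nonneg hρ0 hĜ0).eq_or_lt
  · rw [← h0, mul_zero, zero_div, mul_zero]
    refine DPGD.integral_subopt_le hne (hint c) fun z hz => ?_
    have hz0 : 2 * √n * ρ * G ≤ 0 := by
      have := mul_le_mul_of_nonneg_left hĜ hρ0
      linarith
    have hp (ω : Ω) :
        U (∑ i, DPGD.avgIter U C (fun k => c / √k) η (fun k => w k ω) r₁ K i) ≤ U (∑ i, z i) := by
      obtain ⟨m, rfl⟩ : ∃ m, K = m + 1 := ⟨K - 1, by omega⟩
      have := DPGD.sub_le_of_mem_feasible hd hU hρ hG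
        (DPGD.avgIter_succ_mem_feasible (U := U) (r₁ := r₁) (α := fun k => c / √k) hc hcl hne hη
          (fun k => w k ω) m) hz
      linarith
    have := integral_mono (hint c) (integrable_const (U (∑ i, z i))) hp
    simp only [integral_const, probReal_univ, one_smul] at this
    linarith
  · have hρ1 : 0 < ρ := pos_of_mul_pos_left h0 hĜ0
    have hĜ1 : 0 < DPGD.gradConst n T K G L Δ ε := pos_of_mul_pos_right h0 hρ0
    refine (hmain c (hcdef ▸ div_pos hρ1 hĜ1)).trans_eq ?_
    rw [hcdef]
    field_simp
    ring
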